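/- For real numbers $\theta,\phi$ put \[ L(\theta,\phi)=\liminf_{|q|\to\infty,\ q\in\mathbb Z} |q|\,\|q\theta-\phi\| , \] where $\|x\|$ denotes the distance from the real number $x$ to the nearest integer and $q$ runs through the integers of both signs. Let $n\ge 2$ be an odd integer. Then for every integer $m\not\equiv 0 \pmod n$, \[ L\bigl(e^{2/(n+1)},\, m/n\bigr)=0 \quad\text{and}\quad L\bigl(e^{2/(n-1)},\, -m\,e^{2/(n-1)}/n\bigr)=0 . \] -/

import Mathlib

/-- `‖x‖`: the distance from the real number `x` to the nearest integer. -/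
noncomputable def distNearestInt (x : ℝ) : ℝ := |x - round x|

/-- The inhomogeneous approximation constant
`L(θ, φ) = liminf_{|q| → ∞} |q| ‖q θ - φ‖`, the lower limit being over all integers `q`
(of both signs). It is taken in the extended reals, so that it is a genuine lower limit
even where it is infinite. -/
noncomputable def inhomApproxConst (θ φ : ℝ) : EReal :=
  Filter.liminf
    (fun q : ℤ => ((|(q : ℝ)| * distNearestInt ((q : ℝ) * θ - φ) : ℝ) : EReal))
    (Filter.comap (fun q : ℤ => |q|) Filter.atTop)

/-! ### Reduction to good approximations in a residue class. -/

open Filter Topology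

/-! Put θ = e^{1/k}. Its diagonal Padé approximants P_j/Q_j satisfy Q_j |Q_j θ - P_j| → 0
(`tendsto_expPadeSeq_mul_abs`). If c Q_j ≡ b and c P_j ≡ a mod n with 0 < c ≤ n, then q = (c Q_j -
b)/n and p = (c P_j - a)/n give qθ - (a - bθ)/n - p = (c/n)(Q_j θ - P_j), so L(θ, (a - bθ)/n) = 0.
For k = (n+1)/2, Q_1 = 2k - 1 = n; for k = (n-1)/2, P_1 = 2k + 1 = n. The recurrence is periodic mod
n, so this divisibility recurs (`frequently_dvd_expPadeSeq`). The determinant ±2 makes the other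
entry prime to the odd n, hence some multiple of it is ≡ m. -/

theorem inhomApproxConst_eq_zero_of_forall {θ φ : ℝ}
    (h : ∀ ε : ℝ, 0 < ε → ∀ N : ℤ, ∃ q : ℤ, N ≤ |q| ∧
      |(q : ℝ)| * distNearestInt ((q : ℝ) * θ - φ) ≤ ε) :
    inhomApproxConst θ φ = 0 := by
  unfold inhomApproxConst
  apply le_antisymm
  · apply EReal.le_of_forall_lt_iff_le.1
    intro z hz
    have hz' : 0 < z := by exact_mod_cast hz
    apply Filter.liminf_le_of_frequently_le'
    rw [Filter.frequently_iff]
    intro U hU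
    obtain ⟨t, ht, htU⟩ := Filter.mem_comap.1 hU
    obtain ⟨N, hN⟩ := Filter.mem_atTop_sets.1 ht
    obtain ⟨q, hq, hle⟩ := h z hz' N
    exact ⟨q, htU (hN _ hq), by exact_mod_cast hle⟩
  · apply Filter.le_liminf_of_le
    · isBoundedDefault
    · refine Filter.Eventually.of_forall fun q => ?_
      have : 0 ≤ |(q : ℝ)| * distNearestInt ((q : ℝ) * θ - φ) :=
        mul_nonneg (abs_nonneg _) (abs_nonneg _)
      exact_mod_cast this

/-- If the integer vectors `(Q j, P j)` satisfy `Q j → ∞` and `Q j * |Q j * θ - P j| → 0`, and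
infinitely many of them have a bounded multiple in the residue class of `(b, a)` modulo `n`, then the corresponding
inhomogeneous approximation constant vanishes. -/
theorem inhomApproxConst_eq_zero_of_frequently {θ : ℝ} {n : ℤ} (hn : 0 < n) (a b : ℤ)
    {P Q : ℕ → ℤ} (hQ : ∀ j, 0 < Q j) (hQtop : Tendsto Q atTop atTop)
    (hsmall : Tendsto (fun j => (Q j : ℝ) * |(Q j : ℝ) * θ - P j|) atTop (𝓝 0))
    (hcong : ∃ᶠ j in atTop, ∃ c : ℤ, 0 < c ∧ c ≤ n ∧ n ∣ c * Q j - b ∧ n ∣ c * P j - a) :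
    inhomApproxConst θ (((a : ℝ) - b * θ) / n) = 0 := by
  apply inhomApproxConst_eq_zero_of_forall
  intro ε hε N
  have h1 : Tendsto (fun j => (1 + |(b : ℝ)|) * ((Q j : ℝ) * |(Q j : ℝ) * θ - P j|))
      atTop (𝓝 0) := by simpa using hsmall.const_mul (1 + |(b : ℝ)|)
  -- The threshold on `Q j` forces `|q| ≥ |N|`, since `n * |q| = |c * Q j - b| ≥ Q j - |b|`.
  obtain ⟨j, ⟨c, hc, hcn, ⟨q, hq⟩, ⟨p, hp⟩⟩, hε', hQN⟩ :=
    (hcong.and_eventually ((h1.eventually_le_const hε).and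
      (hQtop.eventually_ge_atTop (n * |N| + |b|)))).exists
  refine ⟨q, ?_, ?_⟩
  · have h2 : n * |q| = |c * Q j - b| := by rw [hq, abs_mul, abs_of_pos hn]
    have h3 : Q j ≤ c * Q j := le_mul_of_one_le_left (hQ j).le hc
    have h4 : c * Q j - b ≤ |c * Q j - b| := le_abs_self _
    have h5 : n * |N| ≤ n * |q| := by linarith [le_abs_self b]
    exact (le_abs_self N).trans (le_of_mul_le_mul_left h5 hn)
  · have hnR : (0 : ℝ) < n := by exact_mod_cast hn
    have hcR : (0 : ℝ) < c := by exact_mod_cast hc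
    have hcnR : (c : ℝ) ≤ n := by exact_mod_cast hcn
    have hQR : (1 : ℝ) ≤ Q j := by exact_mod_cast hQ j
    have hqR : (c : ℝ) * Q j - b = n * q := by exact_mod_cast hq
    have hpR : (c : ℝ) * P j - a = n * p := by exact_mod_cast hp
    have hdist : distNearestInt ((q : ℝ) * θ - ((a : ℝ) - b * θ) / n) ≤
        |(Q j : ℝ) * θ - P j| := by
      refine (round_le _ p).trans ?_
      have : (q : ℝ) * θ - ((a : ℝ) - b * θ) / n - p = c / n * ((Q j : ℝ) * θ - P j) := by
        field_simp
        linear_combination (-θ) * hqR + hpR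
      rw [this, abs_mul, abs_of_pos (div_pos hcR hnR)]
      exact mul_le_of_le_one_left (abs_nonneg _) ((div_le_one hnR).2 hcnR)
    have habs : |(q : ℝ)| ≤ (1 + |(b : ℝ)|) * Q j := by
      have h2 : n * |(q : ℝ)| ≤ n * ((1 + |(b : ℝ)|) * Q j) := by
        rw [← abs_of_pos hnR, ← abs_mul, abs_of_pos hnR, ← hqR]
        have hn1 : (1 : ℝ) ≤ n := by exact_mod_cast hn
        calc |(c : ℝ) * Q j - b| ≤ |(c : ℝ) * Q j| + |(b : ℝ)| := abs_sub _ _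
          _ = c * Q j + |(b : ℝ)| := by rw [abs_of_pos (by positivity)]
          _ ≤ n * Q j + n * (|(b : ℝ)| * Q j) := by
            refine add_le_add (by gcongr) ?_
            calc |(b : ℝ)| ≤ |(b : ℝ)| * Q j := le_mul_of_one_le_right (abs_nonneg _) hQR
              _ ≤ _ := le_mul_of_one_le_left (by positivity) hn1
          _ = _ := by ring
      exact le_of_mul_le_mul_left h2 hnR
    calc _ ≤ ((1 + |(b : ℝ)|) * Q j) * |(Q j : ℝ) * θ - P j| :=
          mul_le_mul habs hdist (abs_nonneg _) (by positivity)
      _ ≤ ε := by rw [mul_assoc]; exact hε'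

/-! ### The Padé recurrence and its arithmetic modulo n. -/

/-- The recurrence satisfied by the numerators and the denominators of the diagonal Padé
approximants to `exp (1 / k)`. -/
def expPadeSeq (k u v : ℤ) : ℕ → ℤ
  | 0 => u
  | 1 => v
  | j + 2 => 2 * (2 * j + 3) * k * expPadeSeq k u v (j + 1) + expPadeSeq k u v j

theorem expPadeSeq_add_two (k u v : ℤ) (j : ℕ) : expPadeSeq k u v (j + 2) =
    2 * (2 * j + 3) * k * expPadeSeq k u v (j + 1) + expPadeSeq k u v j := by
  rw [expPadeSeq]

/-- One step of the recurrence of `expPadeSeq`, modulo `n`. -/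
def expPadeStep (k : ℤ) (n : ℕ) (s : ZMod n × ZMod n × ZMod n) : ZMod n × ZMod n × ZMod n :=
  (s.1 + 1, s.2.2, 2 * (2 * s.1 + 3) * k * s.2.2 + s.2.1)

/-- The oldest term enters with coefficient 1, so a step can be undone for every `k` and `n`. The
index mod `n` belongs to the state because the coefficients depend on it. -/
theorem expPadeStep_injective (k : ℤ) (n : ℕ) : Function.Injective (expPadeStep k n) := by
  rintro ⟨i, x, y⟩ ⟨i', x', y'⟩ h
  simp only [expPadeStep, Prod.mk.injEq, add_left_inj] at h
  obtain ⟨rfl, rfl, h⟩ := h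
  simpa using h

theorem expPadeStep_iterate (k u v : ℤ) (n j : ℕ) :
    (expPadeStep k n)^[j] (0, (u : ZMod n), (v : ZMod n)) =
      ((j : ZMod n), (expPadeSeq k u v j : ZMod n), (expPadeSeq k u v (j + 1) : ZMod n)) := by
  induction j with
  | zero => simp [expPadeSeq]
  | succ j ih =>
    rw [Function.iterate_succ_apply', ih, expPadeStep, expPadeSeq_add_two]
    push_cast
    rfl

/-- Modulo `n`, the sequence `expPadeSeq` is purely periodic. -/
theorem frequently_dvd_expPadeSeq (k u v : ℤ) {n : ℕ} (hn : n ≠ 0) (hv : (n : ℤ) ∣ v) :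
    ∃ᶠ j in atTop, (n : ℤ) ∣ expPadeSeq k u v j := by
  have : NeZero n := ⟨hn⟩
  obtain ⟨T, hT, hper⟩ := Function.mem_periodicPts.1
    ((expPadeStep_injective k n).mem_periodicPts (0, (u : ZMod n), (v : ZMod n)))
  rw [Filter.frequently_atTop]
  intro N
  -- Index 1 carries the value `v`, which `n` divides.
  refine ⟨T * N + 1, by nlinarith, ?_⟩
  have h := hper.mul_const N
  rw [Function.IsPeriodicPt, Function.IsFixedPt, expPadeStep_iterate] at h
  rw [← ZMod.intCast_zmod_eq_zero_iff_dvd]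
  simp only [Prod.mk.injEq] at h
  rw [h.2.2]
  exact (ZMod.intCast_zmod_eq_zero_iff_dvd _ _).2 hv

theorem le_expPadeSeq {k u v : ℤ} (hk : 1 ≤ k) (hu : 1 ≤ u) (hv : 1 ≤ v) (j : ℕ) :
    1 ≤ expPadeSeq k u v j ∧ (j : ℤ) ≤ expPadeSeq k u v j := by
  suffices h : (1 ≤ expPadeSeq k u v j ∧ (j : ℤ) ≤ expPadeSeq k u v j) ∧
      1 ≤ expPadeSeq k u v (j + 1) ∧ (j : ℤ) + 1 ≤ expPadeSeq k u v (j + 1) from h.1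
  induction j with
  | zero => simp only [expPadeSeq]; push_cast; omega
  | succ j ih =>
    obtain ⟨⟨h1, h2⟩, h3, h4⟩ := ih
    have h5 : expPadeSeq k u v (j + 1) ≤
        2 * (2 * j + 3) * k * expPadeSeq k u v (j + 1) := by
      apply le_mul_of_one_le_left (by omega)
      nlinarith
    refine ⟨⟨h3, by push_cast; exact h4⟩, ?_⟩
    rw [expPadeSeq_add_two]
    push_cast
    omega

theorem expPadeSeq_det (k u v u' v' : ℤ) (j : ℕ) :
    expPadeSeq k u v (j + 1) * expPadeSeq k u' v' j -
      expPadeSeq k u v j * expPadeSeq k u' v' (j + 1) = (-1) ^ j * (v * u' - u * v') := by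
  induction j with
  | zero => simp [expPadeSeq]
  | succ j ih =>
    rw [expPadeSeq_add_two, expPadeSeq_add_two, pow_succ]
    linear_combination -ih

/-! ### The Padé remainder and its decay. -/

/-- The coefficients of the remainder of the diagonal Padé approximation to `exp`. -/
noncomputable def expPadeCoeff (j s : ℕ) : ℝ := s.descFactorial j / (s + 1 + j).factorial

theorem expPadeCoeff_nonneg (j s : ℕ) : 0 ≤ expPadeCoeff j s := by
  unfold expPadeCoeff; positivity

theorem expPadeCoeff_le (j s : ℕ) : expPadeCoeff j s ≤ 1 / s.factorial := by
  unfold expPadeCoeff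
  rw [div_le_div_iff₀ (by positivity) (by positivity), one_mul]
  norm_cast
  calc s.descFactorial j * s.factorial ≤ (s + 1) ^ (1 + j) * s.factorial := by
        gcongr
        calc s.descFactorial j ≤ s ^ j := Nat.descFactorial_le_pow s j
          _ ≤ (s + 1) ^ j := by gcongr; omega
          _ ≤ (s + 1) ^ (1 + j) := by gcongr <;> omega
    _ = s.factorial * (s + 1) ^ (1 + j) := mul_comm _ _
    _ ≤ (s + (1 + j)).factorial := Nat.factorial_mul_pow_le_factorial
    _ = _ := by rw [add_assoc]

/-- The remainder of the diagonal Padé approximation to `exp`. -/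
noncomputable def expPadeRem (j : ℕ) (x : ℝ) : ℝ := ∑' s, expPadeCoeff j s * x ^ (s + 1)

theorem summable_expPadeRem (j : ℕ) {x : ℝ} (hx : 0 ≤ x) :
    Summable fun s => expPadeCoeff j s * x ^ (s + 1) := by
  refine Summable.of_nonneg_of_le (fun s => mul_nonneg (expPadeCoeff_nonneg j s) (by positivity))
    (fun s => ?_) ((Real.summable_pow_div_factorial x).mul_left x)
  calc expPadeCoeff j s * x ^ (s + 1) ≤ 1 / s.factorial * x ^ (s + 1) := by
        gcongr; exact expPadeCoeff_le j s
    _ = _ := by ring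

theorem hasSum_expPadeRem (j : ℕ) {x : ℝ} (hx : 0 ≤ x) :
    HasSum (fun s => expPadeCoeff j s * x ^ (s + 1)) (expPadeRem j x) :=
  (summable_expPadeRem j hx).hasSum

theorem expPadeRem_pos (j : ℕ) {x : ℝ} (hx : 0 < x) : 0 < expPadeRem j x := by
  refine (summable_expPadeRem j hx.le).tsum_pos
    (fun s => mul_nonneg (expPadeCoeff_nonneg j s) (by positivity)) j ?_
  have : 0 < j.descFactorial j := Nat.descFactorial_pos.2 le_rfl
  unfold expPadeCoeff
  positivity

theorem hasSum_expPadeRem_succ (j : ℕ) {x : ℝ} (hx : 0 < x) :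
    HasSum (fun s => expPadeCoeff (j + 1) (s + 1) * x ^ (s + 1)) (x⁻¹ * expPadeRem (j + 1) x) := by
  have h := (hasSum_nat_add_iff' 1).2 ((hasSum_expPadeRem (j + 1) hx.le).mul_left x⁻¹)
  have h0 : expPadeCoeff (j + 1) 0 = 0 := by simp [expPadeCoeff]
  simp only [Finset.sum_range_one, h0, zero_mul, mul_zero, sub_zero] at h
  have e (s : ℕ) : x⁻¹ * (expPadeCoeff (j + 1) (s + 1) * x ^ (s + 1 + 1)) =
      expPadeCoeff (j + 1) (s + 1) * x ^ (s + 1) := by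
    rw [pow_succ _ (s + 1)]
    field_simp
  simpa only [e] using h

/-- After removing common factors this is (s-j)(s-j-1) = (s+j+2)(s+j+3) - 2(2j+3)(s+1). -/
theorem expPadeCoeff_add_two (j s : ℕ) : expPadeCoeff (j + 2) s =
    expPadeCoeff j s - 2 * (2 * j + 3) * expPadeCoeff (j + 1) (s + 1) := by
  unfold expPadeCoeff
  have e1 : (s + 1 + (j + 2)).factorial = (s + j + 3) * ((s + j + 2) * (s + 1 + j).factorial) := by
    rw [show s + 1 + (j + 2) = (s + 1 + j) + 1 + 1 by ring, Nat.factorial_succ, Nat.factorial_succ]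
    ring
  have e2 : (s + 1 + 1 + (j + 1)).factorial =
      (s + j + 3) * ((s + j + 2) * (s + 1 + j).factorial) := by
    rw [← e1]; congr 1; ring
  have e3 : ((s.descFactorial (j + 2) : ℕ) : ℝ) =
      ((s : ℝ) - j - 1) * (((s : ℝ) - j) * s.descFactorial j) := by
    rw [Nat.descFactorial_succ, Nat.descFactorial_succ]
    rcases lt_or_ge s j with h | h
    · simp [Nat.descFactorial_of_lt h]
    rcases h.eq_or_lt with rfl | h
    · simp
    · push_cast [Nat.cast_sub h.le, Nat.cast_sub (show j + 1 ≤ s from h)]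
      ring
  rw [e1, e2, e3, Nat.succ_descFactorial_succ]
  have : ((s + 1 + j).factorial : ℝ) ≠ 0 := by positivity
  push_cast
  field_simp
  ring

theorem expPadeRem_add_two (j : ℕ) {x : ℝ} (hx : 0 < x) : expPadeRem (j + 2) x =
    expPadeRem j x - 2 * (2 * j + 3) * x⁻¹ * expPadeRem (j + 1) x := by
  have h := (hasSum_expPadeRem j hx.le).sub
    ((hasSum_expPadeRem_succ j hx).mul_left (2 * (2 * j + 3) : ℝ))
  refine ((tsum_congr fun s => ?_).trans h.tsum_eq).trans (by ring)
  rw [expPadeCoeff_add_two]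
  ring

theorem hasSum_exp_sub_one (x : ℝ) :
    HasSum (fun s : ℕ => x ^ (s + 1) / (s + 1).factorial) (Real.exp x - 1) := by
  have h := NormedSpace.expSeries_div_hasSum_exp (𝔸 := ℝ) x
  rw [← Real.exp_eq_exp_ℝ] at h
  simpa using (hasSum_nat_add_iff' 1).2 h

theorem expPadeRem_zero {x : ℝ} (hx : 0 ≤ x) : expPadeRem 0 x = Real.exp x - 1 := by
  refine (hasSum_expPadeRem 0 hx).unique ?_
  convert hasSum_exp_sub_one x using 2 with s
  simp [expPadeCoeff]
  ring

theorem expPadeRem_one {x : ℝ} (hx : 0 < x) :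
    expPadeRem 1 x = Real.exp x + 1 - 2 * x⁻¹ * (Real.exp x - 1) := by
  have h := (hasSum_nat_add_iff' 1).2 ((hasSum_exp_sub_one x).mul_left x⁻¹)
  refine ((tsum_congr fun s => ?_).trans
    ((hasSum_exp_sub_one x).sub (h.mul_left 2)).tsum_eq).trans ?_
  · simp only [expPadeCoeff, Nat.descFactorial_one, Nat.factorial_succ (s + 1)]
    push_cast
    field_simp
    ring
  · simp
    field_simp
    ring

theorem expPadeRem_eq {k : ℤ} (hk : 1 ≤ k) (j : ℕ) :
    (expPadeSeq k 1 (2 * k - 1) j : ℝ) * Real.exp (1 / k) - expPadeSeq k 1 (2 * k + 1) j =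
      (-1) ^ j * expPadeRem j (1 / k) := by
  have hkR : (0 : ℝ) < k := by exact_mod_cast hk
  have hx : (0 : ℝ) < 1 / k := by positivity
  induction j using Nat.twoStepInduction with
  | zero => simp [expPadeSeq, expPadeRem_zero (x := (k : ℝ)⁻¹) (by positivity)]
  | one =>
    simp only [expPadeSeq, expPadeRem_one hx]
    push_cast
    field_simp
    ring
  | more j h1 h2 =>
    rw [expPadeSeq_add_two, expPadeSeq_add_two, expPadeRem_add_two j hx]
    simp only [one_div, inv_inv] at h1 h2 ⊢
    push_cast
    rw [pow_succ] at h2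
    rw [pow_succ, pow_succ]
    linear_combination h1 + 2 * (2 * j + 3) * k * h2

/-- The recurrences for denominators and remainders have opposite signs, so this combination does
not depend on `j`. -/
theorem expPadeSeq_mul_expPadeRem_add {k : ℤ} (hk : 1 ≤ k) (j : ℕ) :
    (expPadeSeq k 1 (2 * k - 1) (j + 1) : ℝ) * expPadeRem j (1 / k) +
      expPadeSeq k 1 (2 * k - 1) j * expPadeRem (j + 1) (1 / k) = 2 := by
  have hkR : (0 : ℝ) < k := by exact_mod_cast hk
  have hx : (0 : ℝ) < 1 / k := by positivity
  induction j with
  | zero =>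
    simp only [expPadeSeq, expPadeRem_one hx, expPadeRem_zero hx.le]
    push_cast
    field_simp
    ring
  | succ j ih =>
    rw [expPadeSeq_add_two, expPadeRem_add_two j hx]
    simp only [one_div, inv_inv] at ih ⊢
    push_cast
    linear_combination ih

theorem tendsto_expPadeSeq_mul_abs {k : ℤ} (hk : 1 ≤ k) :
    Tendsto (fun j => (expPadeSeq k 1 (2 * k - 1) j : ℝ) *
      |(expPadeSeq k 1 (2 * k - 1) j : ℝ) * Real.exp (1 / k) - expPadeSeq k 1 (2 * k + 1) j|)
      atTop (𝓝 0) := by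
  have hkR : (1 : ℝ) ≤ k := by exact_mod_cast hk
  have hx : (0 : ℝ) < 1 / k := by positivity
  have hQ (j : ℕ) : (0 : ℝ) < expPadeSeq k 1 (2 * k - 1) j := by
    exact_mod_cast (le_expPadeSeq hk le_rfl (by omega) j).1
  refine (tendsto_add_atTop_iff_nat 1).1 (squeeze_zero (fun j => ?_) (fun j => ?_)
    (tendsto_const_div_atTop_nhds_zero_nat 2 |>.comp (tendsto_add_atTop_nat 1)))
  · exact mul_nonneg (hQ _).le (abs_nonneg _)
  rw [expPadeRem_eq hk, abs_mul, abs_pow, abs_neg, abs_one, one_pow, one_mul,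
    abs_of_pos (expPadeRem_pos _ hx)]
  have h1 := expPadeSeq_mul_expPadeRem_add hk j
  have h2 := expPadeRem_add_two j hx
  have h3 := expPadeRem_pos (j + 2) hx
  have h4 := expPadeRem_pos (j + 1) hx
  rw [one_div, inv_inv, ← one_div] at h2
  -- Positivity of the next remainder makes the remainders drop by a factor of at least `j + 1`; the
  -- invariant 2 then bounds the product at `j + 1` by `2 / (j + 1)`.
  have h5 : ((j + 1 : ℕ) : ℝ) * expPadeRem (j + 1) (1 / k) ≤ expPadeRem j (1 / k) := by
    have : ((j + 1 : ℕ) : ℝ) ≤ 2 * (2 * j + 3) * k := by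
      push_cast
      nlinarith [(Nat.cast_nonneg j : (0 : ℝ) ≤ j)]
    nlinarith [mul_le_mul_of_nonneg_right this h4.le]
  have h6 := mul_le_mul_of_nonneg_left h5 (hQ (j + 1)).le
  have h7 := mul_pos (hQ j) h4
  simp only [Function.comp_apply]
  rw [le_div_iff₀ (by positivity)]
  linarith

/-! ### Choosing the multiplier and conclusion. -/

theorem Int.exists_dvd_mul_sub {n : ℕ} {m r : ℤ} (hn : n ≠ 0) (hm : ¬ (n : ℤ) ∣ m)
    (hr : IsCoprime (n : ℤ) r) : ∃ c : ℤ, 0 < c ∧ c ≤ n ∧ (n : ℤ) ∣ c * r - m := by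
  obtain ⟨s, t, hst⟩ := hr
  have hn' : (0 : ℤ) < n := by omega
  have hdvd : (n : ℤ) ∣ (t * m % n) * r - m :=
    ⟨-(s * m) - t * m / n * r, by
      linear_combination r * Int.emod_add_mul_ediv (t * m) n + m * hst⟩
  -- The multiplier is `m` times an inverse of `r`; it is nonzero mod `n` because `n` does not
  -- divide `m`.
  refine ⟨t * m % n, lt_of_le_of_ne (Int.emod_nonneg _ hn'.ne') fun h => hm ?_,
    (Int.emod_lt_of_pos _ hn').le, hdvd⟩
  rw [← h] at hdvd
  simpa using hdvd

theorem isCoprime_of_dvd_expPadeSeq {k u v u' v' : ℤ} {n : ℤ} {j : ℕ}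
    (hn : IsCoprime n (v * u' - u * v')) (h : n ∣ expPadeSeq k u v j) :
    IsCoprime n (expPadeSeq k u' v' j) := by
  obtain ⟨w, hw⟩ := h
  have hdet := expPadeSeq_det k u v u' v' j
  have h1 : IsCoprime n ((-1) ^ j * (v * u' - u * v')) :=
    (isCoprime_mul_unit_left_right (isUnit_one.neg.pow j) _ _).2 hn
  rw [← hdet, hw, sub_eq_add_neg, mul_assoc, ← mul_neg, IsCoprime.add_mul_left_right_iff] at h1
  exact h1.of_mul_right_right

theorem inhomApproxConst_exp_eq_zero {k : ℤ} (hk : 1 ≤ k) {n : ℕ} (hn : n ≠ 0) (a b : ℤ)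
    (hcong : ∃ᶠ j in atTop, ∃ c : ℤ, 0 < c ∧ c ≤ n ∧
      (n : ℤ) ∣ c * expPadeSeq k 1 (2 * k - 1) j - b ∧
      (n : ℤ) ∣ c * expPadeSeq k 1 (2 * k + 1) j - a) :
    inhomApproxConst (Real.exp (1 / k)) (((a : ℝ) - b * Real.exp (1 / k)) / n) = 0 := by
  have hQ := le_expPadeSeq hk le_rfl (show 1 ≤ 2 * k - 1 by omega)
  have := inhomApproxConst_eq_zero_of_frequently (n := n) (by omega) a b (fun j => (hQ j).1)
    (tendsto_atTop_mono (fun j => (hQ j).2) tendsto_natCast_atTop_atTop)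
    (tendsto_expPadeSeq_mul_abs hk) hcong
  exact_mod_cast this

theorem corollary11 (n : ℕ) (hn : 2 ≤ n) (hodd : Odd n) (m : ℤ) (hm : ¬ m ≡ 0 [ZMOD (n : ℤ)]) :
    inhomApproxConst (Real.exp (2 / ((n : ℝ) + 1))) ((m : ℝ) / (n : ℝ)) = 0 ∧
    inhomApproxConst (Real.exp (2 / ((n : ℝ) - 1)))
      (-((m : ℝ) * Real.exp (2 / ((n : ℝ) - 1))) / (n : ℝ)) = 0 := by
  have hn0 : n ≠ 0 := by omega
  have hm' : ¬ (n : ℤ) ∣ m := fun h => hm (Int.modEq_zero_iff_dvd.2 h)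
  have hcop : IsCoprime (n : ℤ) 2 := by
    rw [Int.isCoprime_iff_gcd_eq_one]
    exact Nat.coprime_two_right.2 hodd
  obtain ⟨l, hl⟩ := hodd
  have hl1 : 1 ≤ l := by omega
  constructor
  · have h := inhomApproxConst_exp_eq_zero (k := l + 1) (by omega) hn0 m 0 <|
      (frequently_dvd_expPadeSeq (l + 1) 1 (2 * (l + 1) - 1) hn0 ⟨1, by omega⟩).mono fun j hj => by
        obtain ⟨c, hc, hcn, hdvd⟩ := Int.exists_dvd_mul_sub hn0 hm'
          (isCoprime_of_dvd_expPadeSeq (u' := 1) (v' := 2 * (l + 1) + 1)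
            (by simpa only [show ((2 * (l + 1) - 1) * 1 - 1 * (2 * (l + 1) + 1) : ℤ) = -2 by ring]
              using hcop.neg_right) hj)
        exact ⟨c, hc, hcn, by simpa using hj.mul_left c, hdvd⟩
    have e : (2 : ℝ) / (n + 1) = 1 / ((l + 1 : ℤ) : ℝ) := by
      rw [hl]; push_cast; field_simp; ring
    rw [e]
    simpa using h
  · have h := inhomApproxConst_exp_eq_zero (k := l) (by omega) hn0 0 m <|
      (frequently_dvd_expPadeSeq l 1 (2 * l + 1) hn0 ⟨1, by omega⟩).mono fun j hj => by
        obtain ⟨c, hc, hcn, hdvd⟩ := Int.exists_dvd_mul_sub hn0 hm'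
          (isCoprime_of_dvd_expPadeSeq (u' := 1) (v' := 2 * l - 1)
            (by simpa only [show ((2 * l + 1) * 1 - 1 * (2 * l - 1) : ℤ) = 2 by ring] using hcop) hj)
        exact ⟨c, hc, hcn, hdvd, by simpa using hj.mul_left c⟩
    have e : (2 : ℝ) / (n - 1) = 1 / ((l : ℤ) : ℝ) := by
      have : (l : ℝ) ≠ 0 := by positivity
      rw [hl]; push_cast; rw [add_sub_cancel_right]; field_simp
    rw [e]
    simpa using h
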